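/- **Theorem (explicit threshold).** Let $f:\mathbb{R}^n\to\mathbb{R}$ and $h:\mathbb{R}^n\to\mathbb{R}^m$ be smooth, let $\nabla_x^\top h(x)$ denote the Jacobian of $h$ and $\nabla_x h(x)$ its transpose, let $\Omega=\{x: h(x)=0\}$, and let all norms be Euclidean (operator norms for matrices). Assume: 1. there are $\underline m,\overline m>0$ with $\nabla_x^\top h(x)\nabla_x h(x)\succeq \underline m I$ (in particular the Jacobian has full row rank) and $\|\nabla_x^\top h(x)\nabla_x h(x)\|\le\overline m$ for all $x\in\mathbb{R}^n$; 2. $\Omega$ is connected and there is $\rho_\eta>0$ with $f(y)\ge f(x)+\nabla_x^\top f(x)(y-x)+\frac{\rho_\eta}{2}\|y-x\|^2$ for all $x,y\in\Omega$; 3. $q:\mathbb{R}^n\to\mathbb{R}^{n-m}$ is a smooth map with $\nabla_x^\top q(x)\nabla_x h(x)=0$ and $\nabla_x^\top q(x)\nabla_x q(x)=I$ for all $x$, such that $\Phi(x)=(h(x),q(x))$ is a global diffeomorphism of $\mathbb{R}^n$; $\Phi$ is globally Lipschitz with some constant $L_\Phi$, and $\Phi^{-1}$ is globally Lipschitz with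 constant $L_\Psi$; 4. there is $L_1\ge 0$ such that for all $y\in\mathbb{R}^m$, $\eta\in\mathbb{R}^{n-m}$, with $\tilde x=\Phi^{-1}(y,\eta)$ and $p=\Phi^{-1}(0,\eta)$, $\|\nabla_x^\top q(\tilde x)\nabla_x f(\tilde x)-\nabla_x^\top q(p)\nabla_x f(p)\|\le L_1\|y\|$; 5. $\varphi(x)=-(\nabla_x^\top h(x)\nabla_x h(x))^{-1}\nabla_x^\top h(x)\nabla_x f(x)$ is globally Lipschitz with constant $L_2$. Put $L_r=\overline m\,L_2L_\Psi$ and $$\kappa=\frac{12L_r}{\underline m}+\frac{64L_r^2}{\underline m^2}+\frac{8L_1^2L_r}{\rho_\eta^2\,\underline m}+\frac{128L_1^2L_r^2}{\rho_\eta^2\,\underline m^2}.$$ Let $k_i>0$ and $k=k_i/k_p$, and suppose that $$k_p\ \ge\ \max\Big\{1,\ \frac{2k}{\underline m},\ \kappa\Big\},\qquad k_i\le\frac{\underline m\,k_p^2}{2}.$$ Then $f$ has a unique minimizer $x^\star$ over $\Omega$, there is a unique $\lambda^\star\in\mathbb{R}^m$ with $\nabla_x f(x^\star)+\nabla_x h(x^\star)\lambda^\star=0$,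 and $(x^\star,\lambda^\star)$ is a globally exponentially stable equilibrium of the PI dynamics $$\dot x=-\nabla_x f(x)-\nabla_x h(x)\lambda,\qquad \dot z=h(x),\qquad \lambda=k_p h(x)+k_i z .$$ That is, $(x^\star,\lambda^\star)$ is an equilibrium, every initial condition $(x(0),z(0))\in\mathbb{R}^n\times\mathbb{R}^m$ has a solution on $[0,\infty)$, and there are $c_\pi,\rho_\pi>0$ such that every solution satisfies, for all $t\ge0$, $$\left\|\begin{bmatrix}x(t)-x^\star\\ \lambda(t)-\lambda^\star\end{bmatrix}\right\|\le c_\pi e^{-\rho_\pi t}\left\|\begin{bmatrix}x(0)-x^\star\\ \lambda(0)-\lambda^\star\end{bmatrix}\right\|.$$ -/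

import Mathlib

open Set ContDiff

/-- `ℝⁿ` with the Euclidean norm. -/
abbrev Euc (n : ℕ) : Type := EuclideanSpace ℝ (Fin n)

/-- `ℝᵐ × ℝᵈ` with the Euclidean norm `‖(u, v)‖² = ‖u‖² + ‖v‖²`. -/
abbrev EucPair (m d : ℕ) : Type := WithLp 2 (Euc m × Euc d)

namespace PIFlow

noncomputable section

/-- The pair `(u, v)` as a stacked vector. -/
def stack {m d : ℕ} (u : Euc m) (v : Euc d) : EucPair m d := WithLp.toLp 2 (u, v)

/-- The Jacobian `∇ᵀ g (x)` as a linear map `ℝⁿ → ℝᵐ`. -/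
def jac {n m : ℕ} (g : Euc n → Euc m) (x : Euc n) : Euc n →L[ℝ] Euc m := fderiv ℝ g x

/-- The transpose `∇ g (x)` of the Jacobian, as a linear map `ℝᵐ → ℝⁿ`. -/
def jacT {n m : ℕ} (g : Euc n → Euc m) (x : Euc n) : Euc m →L[ℝ] Euc n :=
  ContinuousLinearMap.adjoint (jac g x)

/-- The Gram map `∇ᵀ h (x) ∇ h (x)`. -/
def gram {n m : ℕ} (h : Euc n → Euc m) (x : Euc n) : Euc m →L[ℝ] Euc m :=
  (jac h x).comp (jacT h x)

/-- The feasible set `Ω = {x | h x = 0}`. -/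
def feasible {n m : ℕ} (h : Euc n → Euc m) : Set (Euc n) := {x | h x = 0}

/-- `Ω` is connected and `f` is `ρ`-strongly convex on `Ω`
(with the gradient of `f` in the ambient space). -/
def StronglyConvexOnFeasible {n m : ℕ} (f : Euc n → ℝ) (h : Euc n → Euc m) (ρ : ℝ) : Prop :=
  IsConnected (feasible h) ∧
    ∀ x ∈ feasible h, ∀ y ∈ feasible h,
      f x + inner ℝ (gradient f x) (y - x) + ρ / 2 * ‖y - x‖ ^ 2 ≤ f y

/-- The change of coordinates `Φ x = (h x, q x)`. -/
def Phi {n m d : ℕ} (h : Euc n → Euc m) (q : Euc n → Euc d) (x : Euc n) : EucPair m d :=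
  stack (h x) (q x)

/-- `Φ = (h, q)` is a global diffeomorphism with inverse `Ψ`, and the complementary coordinate `q`
is normalized by `∇ᵀq ∇h = 0` and `∇ᵀq ∇q = I` at every point. -/
structure IsNormalForm {n m d : ℕ} (h : Euc n → Euc m) (q : Euc n → Euc d)
    (Ψ : EucPair m d → Euc n) : Prop where
  contDiff_q : ContDiff ℝ ∞ q
  contDiff_inv : ContDiff ℝ ∞ Ψ
  left_inv : Function.LeftInverse Ψ (Phi h q)
  right_inv : Function.RightInverse Ψ (Phi h q)
  orthogonal : ∀ x, (jac q x).comp (jacT h x) = 0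
  orthonormal : ∀ x, (jac q x).comp (jacT q x) = ContinuousLinearMap.id ℝ (Euc d)

/-- `φ (x) = - (∇ᵀh ∇h)⁻¹ (∇ᵀh ∇f)`. -/
def phi {n m : ℕ} (f : Euc n → ℝ) (h : Euc n → Euc m) (x : Euc n) : Euc m :=
  -((gram h x).inverse (jac h x (gradient f x)))

/-- The multiplier `λ = k_p h(x) + k_i z` applied by the proportional-integral controller. -/
def multiplier {n m : ℕ} (h : Euc n → Euc m) (kp ki : ℝ) (x : Euc n) (z : Euc m) : Euc m :=
  kp • h x + ki • z

/-- `(x, z)` solves, for all `t ≥ 0`,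
`ẋ = -∇f(x) - ∇h(x) (k_p h(x) + k_i z)`, `ż = h(x)`. -/
def IsPISolution {n m : ℕ} (f : Euc n → ℝ) (h : Euc n → Euc m) (kp ki : ℝ)
    (x : ℝ → Euc n) (z : ℝ → Euc m) : Prop :=
  ∀ t : ℝ, 0 ≤ t →
    HasDerivWithinAt x
      (-gradient f (x t) - jacT h (x t) (multiplier h kp ki (x t) (z t))) (Ici 0) t ∧
    HasDerivWithinAt z (h (x t)) (Ici 0) t

/-- `(xs, ls)` is a globally exponentially stable equilibrium of the PI dynamics, expressed in the
variables `(x, λ)` with `λ = k_p h(x) + k_i z`: it is the value of a constant solution, every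
initial condition starts a solution defined for all `t ≥ 0`, and all solutions converge to
`(xs, ls)` with a uniform exponential bound. -/
def IsGloballyExpStable {n m : ℕ} (f : Euc n → ℝ) (h : Euc n → Euc m) (kp ki : ℝ)
    (xs : Euc n) (ls : Euc m) : Prop :=
  (∃ zs : Euc m, multiplier h kp ki xs zs = ls ∧
    IsPISolution f h kp ki (fun _ => xs) (fun _ => zs)) ∧
  (∀ (x₀ : Euc n) (z₀ : Euc m), ∃ (x : ℝ → Euc n) (z : ℝ → Euc m),
    IsPISolution f h kp ki x z ∧ x 0 = x₀ ∧ z 0 = z₀) ∧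
  ∃ c > 0, ∃ ρ > 0, ∀ (x : ℝ → Euc n) (z : ℝ → Euc m), IsPISolution f h kp ki x z →
    ∀ t : ℝ, 0 ≤ t →
      ‖stack (x t - xs) (multiplier h kp ki (x t) (z t) - ls)‖ ≤
        c * Real.exp (-ρ * t) * ‖stack (x 0 - xs) (multiplier h kp ki (x 0) (z 0) - ls)‖

/-- The explicit threshold `κ`. -/
def kappa (mlow ρ L₁ Lr : ℝ) : ℝ :=
  12 * Lr / mlow + 64 * Lr ^ 2 / mlow ^ 2 + 8 * L₁ ^ 2 * Lr / (ρ ^ 2 * mlow)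
    + 128 * L₁ ^ 2 * Lr ^ 2 / (ρ ^ 2 * mlow ^ 2)

end

end PIFlow

namespace PIFlow

/-! ### Global solutions and exponential decay from a Lyapunov function -/

/-! In the coordinates `(h, q)` the normalization of `q` makes `η ↦ Ψ(0, η)` and `q` both
1-Lipschitz, so the former is an isometry into a strictly convex space, hence affine
(`slice_sub_slice`). Thus `Ω` is an affine subspace, and the reduced objective is `ρ`-strongly
convex on all of `ℝᵈ`. This yields the unique minimizer; its multiplier is `λ* = φ(x*)`.

For stability, put `μ = λ - λ*`, `θ = kᵢ z - λ*`, `e = q(x) - η*`, `y = h(x)`, so that `k_p y = μ -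
θ`. Then `ẏ = r - a` with `a = gram μ` and `r = gram (φ(x) - φ(x*))`, where `‖r‖ ≤ ℓ(‖y‖ + ‖e‖)`,
and `ė` is a gradient flow perturbed by at most `L₁‖y‖`. The term `a` damps `μ`, the integrator
damps `θ`, and strong convexity damps `e`. With suitable weights on the three squares, large `k_p`
lets this damping absorb every cross term (`lyapunov_dissipation_le`).

The resulting function is equivalent to the squared distance to equilibrium because `Φ` and `Ψ` are
Lipschitz. It gives both global existence, through bounded sublevel sets, and the exponential bound.
-/

theorem le_exp_mul_of_hasDerivWithinAt {W W' : ℝ → ℝ} {δ : ℝ}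
    (hW : ∀ t, 0 ≤ t → HasDerivWithinAt W (W' t) (Ici 0) t)
    (hle : ∀ t, 0 ≤ t → W' t ≤ -δ * W t) {t : ℝ} (ht : 0 ≤ t) :
    W t ≤ Real.exp (-δ * t) * W 0 := by
  have hd : ∀ s, 0 ≤ s → HasDerivWithinAt (fun s => Real.exp (δ * s) * W s)
      (Real.exp (δ * s) * (δ * 1) * W s + Real.exp (δ * s) * W' s) (Ici 0) s := fun s hs =>
    (((hasDerivAt_id s).const_mul δ).exp.hasDerivWithinAt).mul (hW s hs)
  have hanti : AntitoneOn (fun s => Real.exp (δ * s) * W s) (Ici (0 : ℝ)) := by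
    refine antitoneOn_of_hasDerivWithinAt_nonpos (convex_Ici 0)
      (fun s hs => (hd s hs).continuousWithinAt)
      (fun s hs => (hd s (interior_subset hs)).mono interior_subset) (fun s hs => ?_)
    have h1 := hle s (interior_subset hs)
    have h2 := Real.exp_pos (δ * s)
    nlinarith
  have h := hanti (mem_Ici.2 le_rfl) (mem_Ici.2 ht) ht
  simp only [mul_zero, Real.exp_zero, one_mul] at h
  calc W t = Real.exp (-δ * t) * (Real.exp (δ * t) * W t) := by
        rw [← mul_assoc, ← Real.exp_add]; simp
    _ ≤ _ := by gcongr

variable {E : Type*} [NormedAddCommGroup E] [NormedSpace ℝ E]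

theorem exists_global_solution_of_bounded_lipschitz [CompleteSpace E] {w : E → E} {K : NNReal}
    (hK : LipschitzWith K w) {C : NNReal} (hC : ∀ p, ‖w p‖ ≤ C) (x₀ : E) :
    ∃ γ : ℝ → E, γ 0 = x₀ ∧ ∀ t, 0 ≤ t → HasDerivWithinAt γ (w (γ t)) (Ici 0) t := by
  have hloc : ∀ T : ℝ, 0 ≤ T → ∃ α : ℝ → E, α 0 = x₀ ∧
      ∀ t ∈ Icc (0 : ℝ) T, HasDerivWithinAt α (w (α t)) (Icc 0 T) t := by
    intro T hT
    -- A curve of speed at most `C` stays in the ball of radius `C * T` up to time `T`, so any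
    -- horizon is allowed.
    have hpl : IsPicardLindelof (fun _ => w) (tmin := 0) (tmax := T) ⟨0, le_rfl, hT⟩ x₀
        (C * T.toNNReal) 0 C K :=
      .of_time_independent (fun p _ => hC p) hK.lipschitzOnWith (by simp [hT])
    exact hpl.exists_eq_forall_mem_Icc_hasDerivWithinAt₀
  choose α hα0 hα using hloc
  have huniq : ∀ S T (hS : 0 ≤ S) (hT : 0 ≤ T) s, 0 ≤ s → s ≤ S → s ≤ T →
      α S hS s = α T hT s := by
    intro S T hS hT s hs hsS hsT
    have key : ∀ R (hR : 0 ≤ R), s ≤ R → ContinuousOn (α R hR) (Icc 0 s) ∧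
        ∀ t ∈ Ico 0 s, HasDerivWithinAt (α R hR) (w (α R hR t)) (Ici t) t := by
      intro R hR hsR
      refine ⟨fun t ht => ((hα R hR t ⟨ht.1, ht.2.trans hsR⟩).continuousWithinAt).mono
        (Icc_subset_Icc_right hsR), fun t ht => ?_⟩
      refine (hα R hR t ⟨ht.1, ht.2.le.trans hsR⟩).mono_of_mem_nhdsWithin ?_
      exact Filter.mem_of_superset (Icc_mem_nhdsGE (ht.2.trans_le hsR))
        (Icc_subset_Icc_left ht.1)
    exact ODE_solution_unique_of_mem_Icc_right (v := fun _ => w) (s := fun _ => univ)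
      (fun _ _ => hK.lipschitzOnWith) (key S hS hsS).1 (key S hS hsS).2 (fun _ _ => mem_univ _)
      (key T hT hsT).1 (key T hT hsT).2 (fun _ _ => mem_univ _)
      ((hα0 S hS).trans (hα0 T hT).symm) ⟨hs, le_rfl⟩
  classical
  -- The horizon `t + 1` leaves room to the right of `t`, so the derivative there is not one-sided
  -- from the left.
  refine ⟨fun t => if h : 0 ≤ t then α (t + 1) (by linarith) t else x₀, by simp [hα0],
    fun t ht => ?_⟩
  have ht1 : 0 ≤ t + 1 := by linarith
  have hd : HasDerivWithinAt (α (t + 1) ht1) (w (α (t + 1) ht1 t)) (Ici 0) t := by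
    refine (hα (t + 1) ht1 t ⟨ht, by linarith⟩).mono_of_mem_nhdsWithin ?_
    rw [← Ici_inter_Iic, Filter.inter_mem_iff]
    exact ⟨self_mem_nhdsWithin, mem_nhdsWithin_of_mem_nhds (Iic_mem_nhds (by linarith))⟩
  simp only [dif_pos ht]
  refine hd.congr_of_eventuallyEq ?_ (by simp [ht])
  have hnear : ∀ᶠ s in nhdsWithin t (Ici 0), s ≤ t + 1 :=
    mem_nhdsWithin_of_mem_nhds (Iic_mem_nhds (by linarith))
  filter_upwards [self_mem_nhdsWithin, hnear] with s hs hs1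
  have hs0 : 0 ≤ s := hs
  simp only [dif_pos hs0]
  exact huniq _ _ _ _ s hs0 (by linarith) hs1

/-- Cutting `v` off outside a large ball makes it bounded and Lipschitz. The cutoff is a nonnegative
factor, so `V` still decreases; the trajectory therefore stays where the cutoff equals 1 and solves
the original equation. -/
theorem exists_global_solution_of_lyapunov [FiniteDimensional ℝ E] {v : E → E}
    (hv : ContDiff ℝ 1 v) {V : E → ℝ} (hV : Differentiable ℝ V)
    (hdec : ∀ p, fderiv ℝ V p (v p) ≤ 0)
    (hbdd : ∀ c, ∃ R, ∀ p, V p ≤ c → ‖p‖ ≤ R) (x₀ : E) :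
    ∃ γ : ℝ → E, γ 0 = x₀ ∧ ∀ t, 0 ≤ t → HasDerivWithinAt γ (v (γ t)) (Ici 0) t := by
  have : CompleteSpace E := FiniteDimensional.complete ℝ E
  obtain ⟨R, hR⟩ := hbdd (V x₀)
  let χ : ContDiffBump (0 : E) := ⟨max R 0 + 1, max R 0 + 2, by positivity, by linarith⟩
  have hsupp : HasCompactSupport (fun p => χ p • v p) := χ.hasCompactSupport.smul_right
  have hsmooth : ContDiff ℝ 1 (fun p => χ p • v p) := χ.contDiff.smul hv
  obtain ⟨K, hK⟩ := hsmooth.lipschitzWith_of_hasCompactSupport hsupp one_ne_zero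
  obtain ⟨C, hC⟩ := hsupp.exists_bound_of_continuous hsmooth.continuous
  obtain ⟨γ, hγ0, hγ⟩ := exists_global_solution_of_bounded_lipschitz hK
    (C := C.toNNReal) (fun p => (hC p).trans (Real.le_coe_toNNReal C)) x₀
  refine ⟨γ, hγ0, fun t ht => ?_⟩
  have hmono : V (γ t) ≤ V x₀ := by
    have h := le_exp_mul_of_hasDerivWithinAt (W := V ∘ γ) (δ := 0)
      (fun s hs => (hV (γ s)).hasFDerivAt.comp_hasDerivWithinAt s (hγ s hs))
      (fun s _ => by
        simp only [map_smul, smul_eq_mul, neg_zero, zero_mul]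
        exact mul_nonpos_of_nonneg_of_nonpos χ.nonneg (hdec _)) ht
    simpa [hγ0] using h
  have hone : χ (γ t) = 1 := by
    refine χ.one_of_mem_closedBall ?_
    rw [mem_closedBall_zero_iff]
    exact (hR _ hmono).trans ((le_max_left R 0).trans (le_add_of_nonneg_right zero_le_one))
  simpa [hone] using hγ t ht

/-! ### The dissipation inequality -/

theorem normalized_dissipation_le {u t w s g : ℝ} (hu : 0 ≤ u) (ht : 0 ≤ t) (hw : 0 ≤ w)
    (hs : s ≤ 1 / 12) (hg : g ≤ 1 / 11) :
    (u ^ 2 + t ^ 2 + w ^ 2) / 100 ≤ u ^ 2 / 4 + t ^ 2 / 2 + 4 * w ^ 2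
      - s * (u * (u + t)) - u * w - 4 * g * ((u + t) * w) := by
  have h1 : s * (u * (u + t)) ≤ 1 / 12 * (u * (u + t)) := by gcongr
  have h2 : g * ((u + t) * w) ≤ 1 / 11 * ((u + t) * w) := by gcongr
  -- At the extreme values of `s` and `g`, each square absorbs one of the cross terms `u w`, `u t`,
  -- `t w`.
  nlinarith [sq_nonneg (w - 0.1948 * u), sq_nonneg (u - 1.75 * t), sq_nonneg (w - 0.371 * t)]

/-- The rate at which the Lyapunov function decays. -/
noncomputable def decayRate (m ρ kp ki : ℝ) : ℝ :=
  min (m * kp / 100) (min (ki / kp / 100) (ρ / 400))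

theorem decayRate_pos {m ρ kp ki : ℝ} (hm : 0 < m) (hρ : 0 < ρ) (hkp : 0 < kp) (hki : 0 < ki) :
    0 < decayRate m ρ kp ki := by
  unfold decayRate; positivity

theorem scalar_dissipation_le {m ρ kp ki ℓ L₁ u t e : ℝ} (hm : 0 < m) (hρ : 0 < ρ) (hkp : 0 < kp)
    (hki : 0 < ki) (hℓ : 0 < ℓ) (h12 : 12 * ℓ ≤ m * kp)
    (h11 : 11 * (ℓ * L₁) ≤ m * ρ * kp) (hk : 2 * (ki / kp) ≤ m * kp)
    (hu : 0 ≤ u) (ht : 0 ≤ t) (he : 0 ≤ e) :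
    kp * (u * (ℓ * ((u + t) / kp + e))) + (m * kp - ki / kp) * (u * t - u ^ 2) - m * kp * t ^ 2
      - 4 * ℓ ^ 2 * kp / (m * ρ) * (ρ * e ^ 2 - L₁ * ((u + t) / kp) * e) ≤
    -decayRate m ρ kp ki *
      (u ^ 2 + m * kp ^ 2 / ki * t ^ 2 + 4 * ℓ ^ 2 * kp / (m * ρ) * e ^ 2) := by
  -- This scaling makes every term `m * kp` times a quadratic form in `u, t, w` with dimensionless
  -- coefficients.
  set w := ℓ / m * e with hw
  have hw0 : 0 ≤ w := by positivity
  have hs : ℓ / (m * kp) ≤ 1 / 12 := by rw [div_le_div_iff₀ (by positivity) (by norm_num)]; linarith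
  have hg : ℓ * L₁ / (m * ρ * kp) ≤ 1 / 11 := by
    rw [div_le_div_iff₀ (by positivity) (by norm_num)]; linarith
  have hq := mul_le_mul_of_nonneg_left (normalized_dissipation_le hu ht hw0 hs hg)
    (show 0 ≤ m * kp by positivity)
  have e1 : kp * (u * (ℓ * ((u + t) / kp + e)))
      = m * kp * (ℓ / (m * kp) * (u * (u + t)) + u * w) := by rw [hw]; field_simp
  have e2 : 4 * ℓ ^ 2 * kp / (m * ρ) * (ρ * e ^ 2 - L₁ * ((u + t) / kp) * e)
      = m * kp * (4 * w ^ 2 - 4 * (ℓ * L₁ / (m * ρ * kp)) * ((u + t) * w)) := by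
    rw [hw]; field_simp
  have e3 : 4 * ℓ ^ 2 * kp / (m * ρ) * e ^ 2 = 4 * (m * kp) / ρ * w ^ 2 := by
    rw [hw]; field_simp
  -- Young's inequality, followed by `m kp / 2 ≤ m kp - ki / kp ≤ m kp`.
  have hcross : (m * kp - ki / kp) * (u * t - u ^ 2) ≤
      m * kp * (t ^ 2 / 2) - m * kp * (u ^ 2 / 4) := by
    have hk0 : 0 < ki / kp := by positivity
    have a1 : (m * kp - ki / kp) * (u * t - u ^ 2) ≤
        (m * kp - ki / kp) * ((t ^ 2 - u ^ 2) / 2) :=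
      mul_le_mul_of_nonneg_left (by nlinarith [sq_nonneg (u - t)]) (by linarith)
    nlinarith [mul_nonneg (sub_nonneg.2 hk) (sq_nonneg u), mul_nonneg hk0.le (sq_nonneg t)]
  -- Each entry of the minimum in `decayRate` is `m kp / 100` divided by the Lyapunov weight of one
  -- square, in the scaled variables.
  have r1 : decayRate m ρ kp ki * u ^ 2 ≤ m * kp / 100 * u ^ 2 := by
    gcongr; exact min_le_left _ _
  have r2 : decayRate m ρ kp ki * (m * kp ^ 2 / ki * t ^ 2) ≤ m * kp / 100 * t ^ 2 := by
    calc _ ≤ ki / kp / 100 * (m * kp ^ 2 / ki * t ^ 2) := by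
          gcongr; exact (min_le_right _ _).trans (min_le_left _ _)
      _ = _ := by field_simp
  have r3 : decayRate m ρ kp ki * (4 * (m * kp) / ρ * w ^ 2) ≤ m * kp / 100 * w ^ 2 := by
    calc _ ≤ ρ / 400 * (4 * (m * kp) / ρ * w ^ 2) := by
          gcongr; exact (min_le_right _ _).trans (min_le_right _ _)
      _ = _ := by field_simp; ring
  rw [e1, e2, e3]
  linarith

theorem lyapunov_dissipation_le {F G : Type*} [NormedAddCommGroup F] [InnerProductSpace ℝ F]
    [NormedAddCommGroup G] [InnerProductSpace ℝ G] {m ρ kp ki ℓ L₁ : ℝ} (hm : 0 < m) (hρ : 0 < ρ)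
    (hkp : 0 < kp) (hki : 0 < ki) (hℓ : 0 < ℓ) (hL₁ : 0 ≤ L₁) (h12 : 12 * ℓ ≤ m * kp)
    (h11 : 11 * (ℓ * L₁) ≤ m * ρ * kp) (hk : 2 * (ki / kp) ≤ m * kp)
    {μ θ y r a : F} {e g : G} (hy : kp • y = μ - θ) (ha : m * ‖μ‖ ^ 2 ≤ inner ℝ μ a)
    (hr : ‖r‖ ≤ ℓ * (‖y‖ + ‖e‖)) (hg : ρ * ‖e‖ ^ 2 - L₁ * ‖y‖ * ‖e‖ ≤ inner ℝ e g) :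
    inner ℝ μ (kp • (r - a) + ki • y) + m * kp ^ 2 / ki * inner ℝ θ (ki • y)
      - 4 * ℓ ^ 2 * kp / (m * ρ) * inner ℝ e g ≤
    -decayRate m ρ kp ki *
      (‖μ‖ ^ 2 + m * kp ^ 2 / ki * ‖θ‖ ^ 2 + 4 * ℓ ^ 2 * kp / (m * ρ) * ‖e‖ ^ 2) := by
  have hyn : ‖y‖ ≤ (‖μ‖ + ‖θ‖) / kp := by
    rw [le_div_iff₀ hkp]
    calc ‖y‖ * kp = ‖kp • y‖ := by rw [norm_smul, Real.norm_of_nonneg hkp.le, mul_comm]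
      _ ≤ _ := by rw [hy]; exact norm_sub_le _ _
  refine le_trans ?_ (scalar_dissipation_le hm hρ hkp hki hℓ h12 h11 hk (norm_nonneg μ)
    (norm_nonneg θ) (norm_nonneg e))
  have hy' : ki • y = (ki / kp) • (μ - θ) := by
    rw [← hy, smul_smul]; congr 1; field_simp
  have i1 : inner ℝ μ (kp • (r - a) + ki • y) =
      kp * inner ℝ μ r - kp * inner ℝ μ a + ki / kp * (‖μ‖ ^ 2 - inner ℝ μ θ) := by
    rw [hy', inner_add_right, inner_smul_right, inner_smul_right, inner_sub_right,
      inner_sub_right, real_inner_self_eq_norm_sq]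
    ring
  -- The weight `m kp² / ki` is chosen so that `θ` is damped at the same strength `m kp` as `μ`.
  have i2 : m * kp ^ 2 / ki * inner ℝ θ (ki • y) = m * kp * (inner ℝ μ θ - ‖θ‖ ^ 2) := by
    rw [hy', inner_smul_right, inner_sub_right, real_inner_self_eq_norm_sq, real_inner_comm]
    field_simp
  have b1 : kp * inner ℝ μ r ≤ kp * (‖μ‖ * (ℓ * ((‖μ‖ + ‖θ‖) / kp + ‖e‖))) := by
    have := (real_inner_le_norm μ r).trans
      (mul_le_mul_of_nonneg_left (hr.trans (mul_le_mul_of_nonneg_left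
        (add_le_add_left hyn ‖e‖) hℓ.le)) (norm_nonneg μ))
    gcongr
  have b2 : kp * (m * ‖μ‖ ^ 2) ≤ kp * inner ℝ μ a := by gcongr
  have b3 : (m * kp - ki / kp) * inner ℝ μ θ ≤ (m * kp - ki / kp) * (‖μ‖ * ‖θ‖) := by
    refine mul_le_mul_of_nonneg_left (real_inner_le_norm μ θ) ?_
    have : 0 < ki / kp := by positivity
    linarith
  have b4 : 4 * ℓ ^ 2 * kp / (m * ρ) * (ρ * ‖e‖ ^ 2 - L₁ * ((‖μ‖ + ‖θ‖) / kp) * ‖e‖) ≤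
      4 * ℓ ^ 2 * kp / (m * ρ) * inner ℝ e g := by
    refine mul_le_mul_of_nonneg_left (le_trans ?_ hg) (by positivity)
    gcongr
  rw [i1, i2]
  linarith

/-- `Lr` may vanish, but the weight of `‖q - η*‖²` is proportional to `ℓ²` and must be positive;
hence a positive `ℓ ≥ Lr`. -/
theorem exists_pos_margin {m ρ kp L₁ Lr : ℝ} (hm : 0 < m) (hρ : 0 < ρ) (hL₁ : 0 ≤ L₁)
    (hLr : 0 ≤ Lr) (hkp : 1 ≤ kp) (hκ : kappa m ρ L₁ Lr ≤ kp) :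
    ∃ ℓ, 0 < ℓ ∧ Lr ≤ ℓ ∧ 12 * ℓ ≤ m * kp ∧ 11 * (ℓ * L₁) ≤ m * ρ * kp := by
  have hkp0 : 0 < kp := by linarith
  rcases hLr.eq_or_lt with h0 | hpos
  · refine ⟨min (m * kp / 12) (m * ρ * kp / (11 * (L₁ + 1))), by positivity, ?_, ?_, ?_⟩
    · rw [← h0]; positivity
    · linarith [min_le_left (m * kp / 12) (m * ρ * kp / (11 * (L₁ + 1)))]
    · have h1 := min_le_right (m * kp / 12) (m * ρ * kp / (11 * (L₁ + 1)))
      have h3 : 0 < min (m * kp / 12) (m * ρ * kp / (11 * (L₁ + 1))) := by positivity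
      rw [le_div_iff₀ (by positivity)] at h1
      nlinarith
  · refine ⟨Lr, hpos, le_rfl, ?_, ?_⟩
    · have h1 : 12 * Lr / m ≤ kp := by
        refine le_trans ?_ hκ
        unfold kappa
        have : 0 ≤ 64 * Lr ^ 2 / m ^ 2 + 8 * L₁ ^ 2 * Lr / (ρ ^ 2 * m)
          + 128 * L₁ ^ 2 * Lr ^ 2 / (ρ ^ 2 * m ^ 2) := by positivity
        linarith
      rw [div_le_iff₀ hm] at h1
      linarith
    · have h1 : 128 * L₁ ^ 2 * Lr ^ 2 / (ρ ^ 2 * m ^ 2) ≤ kp := by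
        refine le_trans ?_ hκ
        unfold kappa
        have : 0 ≤ 12 * Lr / m + 64 * Lr ^ 2 / m ^ 2 + 8 * L₁ ^ 2 * Lr / (ρ ^ 2 * m) := by
          positivity
        linarith
      rw [div_le_iff₀ (by positivity)] at h1
      -- After squaring, the last term of `κ` suffices, since `11² < 128` and `kp ≤ kp²`.
      refine abs_le_of_sq_le_sq' ?_ (by positivity) |>.2
      have h2 : kp * (ρ ^ 2 * m ^ 2) ≤ kp ^ 2 * (ρ ^ 2 * m ^ 2) := by
        gcongr; nlinarith
      nlinarith [mul_nonneg (sq_nonneg L₁) (sq_nonneg Lr)]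

end PIFlow

namespace PIFlow

/-! ### Geometry of the normal form: the feasible set is an affine subspace -/

section NormalForm

variable {n m d : ℕ} {f : Euc n → ℝ} {h : Euc n → Euc m} {q : Euc n → Euc d}
  {Ψ : EucPair m d → Euc n}

/-- The parametrization of the feasible set by the complementary coordinate. -/
def slice (Ψ : EucPair m d → Euc n) (η : Euc d) : Euc n := Ψ (stack 0 η)

theorem hasFDerivAt_Phi (hh : Differentiable ℝ h) (hq : Differentiable ℝ q) (x : Euc n) :
    HasFDerivAt (Phi h q)
      (((WithLp.prodContinuousLinearEquiv 2 ℝ (Euc m) (Euc d)).symm :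
        Euc m × Euc d →L[ℝ] EucPair m d).comp ((jac h x).prod (jac q x))) x :=
  ((WithLp.prodContinuousLinearEquiv 2 ℝ (Euc m) (Euc d)).symm :
    Euc m × Euc d →L[ℝ] EucPair m d).hasFDerivAt.comp x
      ((hh x).hasFDerivAt.prodMk (hq x).hasFDerivAt)

theorem norm_stack_sq (u : Euc m) (v : Euc d) : ‖stack u v‖ ^ 2 = ‖u‖ ^ 2 + ‖v‖ ^ 2 :=
  WithLp.prod_norm_sq_eq_of_L2 _

theorem norm_stack_le (u : Euc m) (v : Euc d) : ‖stack u v‖ ≤ ‖u‖ + ‖v‖ := by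
  refine abs_le_of_sq_le_sq' ?_ (by positivity) |>.2
  rw [norm_stack_sq]
  nlinarith [norm_nonneg u, norm_nonneg v]

theorem stack_sub_stack (u u' : Euc m) (v v' : Euc d) :
    stack u v - stack u' v' = stack (u - u') (v - v') := rfl

namespace IsNormalForm

theorem differentiable_q (hnf : IsNormalForm h q Ψ) : Differentiable ℝ q :=
  hnf.contDiff_q.differentiable (by simp)

theorem differentiable_inv (hnf : IsNormalForm h q Ψ) : Differentiable ℝ Ψ :=
  hnf.contDiff_inv.differentiable (by simp)

/-- Differentiating `Ψ ∘ Φ = id` shows that the derivative of `Φ` is injective. Vector identities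
can thus be tested against `jac h` and `jac q` separately. -/
theorem eq_zero_of_jac_eq_zero (hnf : IsNormalForm h q Ψ) (hh : Differentiable ℝ h) {x v : Euc n}
    (h1 : jac h x v = 0) (h2 : jac q x v = 0) : v = 0 := by
  have hcomp := (hnf.differentiable_inv (Phi h q x)).hasFDerivAt.comp x
    (hasFDerivAt_Phi hh hnf.differentiable_q x)
  have hid : Ψ ∘ Phi h q = id := hnf.left_inv.comp_eq_id
  rw [hid] at hcomp
  have := congrArg (fun A => A v) (hcomp.unique (hasFDerivAt_id x))
  simpa [h1, h2, ← Prod.zero_eq_mk] using this.symm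

theorem Phi_slice (hnf : IsNormalForm h q Ψ) (η : Euc d) : Phi h q (slice Ψ η) = stack 0 η :=
  hnf.right_inv _

theorem h_slice (hnf : IsNormalForm h q Ψ) (η : Euc d) : h (slice Ψ η) = 0 :=
  congrArg (fun p : EucPair m d => p.fst) (hnf.Phi_slice η)

theorem q_slice (hnf : IsNormalForm h q Ψ) (η : Euc d) : q (slice Ψ η) = η :=
  congrArg (fun p : EucPair m d => p.snd) (hnf.Phi_slice η)

theorem slice_q (hnf : IsNormalForm h q Ψ) {x : Euc n} (hx : x ∈ feasible h) :
    slice Ψ (q x) = x := by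
  have hx' : h x = 0 := hx
  have := hnf.left_inv x
  rwa [Phi, hx'] at this

theorem differentiable_slice (hnf : IsNormalForm h q Ψ) : Differentiable ℝ (slice Ψ) := by
  have : slice Ψ = Ψ ∘ fun η => (WithLp.prodContinuousLinearEquiv 2 ℝ (Euc m) (Euc d)).symm
      ((0 : Euc m), η) := rfl
  rw [this]
  exact hnf.differentiable_inv.comp
    ((ContinuousLinearEquiv.differentiable _).comp
      ((differentiable_const _).prodMk differentiable_id))

theorem jac_q_jacT_q (hnf : IsNormalForm h q Ψ) (x : Euc n) (v : Euc d) :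
    jac q x (jacT q x v) = v :=
  congrArg (fun A => A v) (hnf.orthonormal x)

theorem jac_q_jacT_h (hnf : IsNormalForm h q Ψ) (x : Euc n) (v : Euc m) :
    jac q x (jacT h x v) = 0 :=
  congrArg (fun A => A v) (hnf.orthogonal x)

theorem jac_h_jacT_q (hnf : IsNormalForm h q Ψ) (x : Euc n) (v : Euc d) :
    jac h x (jacT q x v) = 0 := by
  refine ext_inner_left ℝ fun u => ?_
  rw [inner_zero_right, ← ContinuousLinearMap.adjoint_inner_left, jacT,
    ContinuousLinearMap.adjoint_inner_right]
  change inner ℝ (jac q x (jacT h x u)) v = 0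
  rw [hnf.jac_q_jacT_h, inner_zero_left]

theorem fderiv_slice (hnf : IsNormalForm h q Ψ) (hh : Differentiable ℝ h) (η : Euc d) :
    fderiv ℝ (slice Ψ) η = jacT q (slice Ψ η) := by
  have hc := (hnf.differentiable_slice η).hasFDerivAt
  have h1 := (hh (slice Ψ η)).hasFDerivAt.comp η hc
  have h2 := (hnf.differentiable_q (slice Ψ η)).hasFDerivAt.comp η hc
  rw [show h ∘ slice Ψ = fun _ => 0 from funext hnf.h_slice] at h1
  rw [show q ∘ slice Ψ = id from funext hnf.q_slice] at h2
  ext1 v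
  rw [← sub_eq_zero]
  refine hnf.eq_zero_of_jac_eq_zero hh (x := slice Ψ η) ?_ ?_
  · rw [map_sub, hnf.jac_h_jacT_q, sub_zero]
    exact congrArg (fun A => A v) (h1.unique (hasFDerivAt_const 0 η))
  · rw [map_sub, hnf.jac_q_jacT_q, sub_eq_zero]
    exact congrArg (fun A => A v) (h2.unique (hasFDerivAt_id η))

theorem norm_jacT_q (hnf : IsNormalForm h q Ψ) (x : Euc n) (v : Euc d) : ‖jacT q x v‖ = ‖v‖ := by
  rw [← sq_eq_sq₀ (norm_nonneg _) (norm_nonneg _), ← real_inner_self_eq_norm_sq,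
    ← real_inner_self_eq_norm_sq]
  conv_lhs => rw [jacT, ContinuousLinearMap.adjoint_inner_left]
  exact congrArg _ (hnf.jac_q_jacT_q x v)

theorem norm_jacT_q_le (hnf : IsNormalForm h q Ψ) (x : Euc n) : ‖jacT q x‖ ≤ 1 :=
  ContinuousLinearMap.opNorm_le_bound _ zero_le_one fun v => by rw [hnf.norm_jacT_q, one_mul]

theorem norm_jac_q_le (hnf : IsNormalForm h q Ψ) (x : Euc n) : ‖jac q x‖ ≤ 1 := by
  rw [← LinearIsometryEquiv.norm_map ContinuousLinearMap.adjoint (jac q x)]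
  exact hnf.norm_jacT_q_le x

/-- `∇q` is isometric, so its adjoint is a contraction: the slice and its left inverse `q` are both
1-Lipschitz, which forces equality of distances. -/
theorem isometry_slice (hnf : IsNormalForm h q Ψ) (hh : Differentiable ℝ h) :
    Isometry (slice Ψ) := by
  have hs : LipschitzWith 1 (slice Ψ) :=
    lipschitzWith_of_nnnorm_fderiv_le hnf.differentiable_slice fun η => by
      rw [hnf.fderiv_slice hh]; exact hnf.norm_jacT_q_le _
  have hq : LipschitzWith 1 q :=
    lipschitzWith_of_nnnorm_fderiv_le hnf.differentiable_q hnf.norm_jac_q_le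
  refine Isometry.of_dist_eq fun η η' => le_antisymm (by simpa using hs.dist_le_mul η η') ?_
  simpa [hnf.q_slice] using hq.dist_le_mul (slice Ψ η) (slice Ψ η')

/-- Since the isometry `slice Ψ` maps into a strictly convex space, it is affine. -/
theorem slice_sub_slice (hnf : IsNormalForm h q Ψ) (hh : Differentiable ℝ h) (η η' : Euc d) :
    slice Ψ η' - slice Ψ η = jacT q (slice Ψ η) (η' - η) := by
  let A := (hnf.isometry_slice hh).affineIsometryOfStrictConvexSpace
  have hA : ∀ ζ, slice Ψ ζ = A.linearIsometry (ζ - η) + slice Ψ η := fun ζ => by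
    have := A.map_vadd η (ζ - η)
    simpa [A] using this
  -- The linear part of the affine isometry is its derivative at any point, which `fderiv_slice` has
  -- identified.
  have hd : HasFDerivAt (slice Ψ) A.linearIsometry.toContinuousLinearMap η := by
    rw [show slice Ψ = fun ζ => A.linearIsometry.toContinuousLinearMap (ζ - η) + slice Ψ η from
      funext hA]
    exact (A.linearIsometry.toContinuousLinearMap.hasFDerivAt.comp η
      ((hasFDerivAt_id η).sub_const η)).add_const _
  rw [← hnf.fderiv_slice hh, hd.fderiv, hA η']
  simp

end IsNormalForm

/-- The gradient of the reduced objective `f ∘ slice Ψ`. -/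
noncomputable def reducedGradient (f : Euc n → ℝ) (q : Euc n → Euc d) (Ψ : EucPair m d → Euc n)
    (η : Euc d) : Euc d :=
  jac q (slice Ψ η) (gradient f (slice Ψ η))

theorem reduced_strongly_convex (hnf : IsNormalForm h q Ψ) (hh : Differentiable ℝ h) {ρ : ℝ}
    (hconv : StronglyConvexOnFeasible f h ρ) (η η' : Euc d) :
    f (slice Ψ η) + inner ℝ (reducedGradient f q Ψ η) (η' - η) + ρ / 2 * ‖η' - η‖ ^ 2 ≤
      f (slice Ψ η') := by
  have := hconv.2 _ (hnf.h_slice η) _ (hnf.h_slice η')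
  rwa [hnf.slice_sub_slice hh, hnf.norm_jacT_q, jacT,
    ContinuousLinearMap.adjoint_inner_right] at this

theorem hasFDerivAt_reduced (hnf : IsNormalForm h q Ψ) (hh : Differentiable ℝ h)
    (hf : Differentiable ℝ f) (η : Euc d) :
    HasFDerivAt (f ∘ slice Ψ) (innerSL ℝ (reducedGradient f q Ψ η)) η := by
  have hcomp := (hf (slice Ψ η)).hasFDerivAt.comp η (hnf.differentiable_slice η).hasFDerivAt
  refine hcomp.congr_fderiv ?_
  ext1 v
  rw [hnf.fderiv_slice hh]
  symm
  change inner ℝ (jac q (slice Ψ η) (gradient f (slice Ψ η))) v =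
    fderiv ℝ f (slice Ψ η) (jacT q (slice Ψ η) v)
  rw [← inner_gradient_left, jacT, ContinuousLinearMap.adjoint_inner_right]

theorem exists_reduced_critical_point (hnf : IsNormalForm h q Ψ) (hh : Differentiable ℝ h)
    (hf : Differentiable ℝ f) {ρ : ℝ} (hρ : 0 < ρ) (hconv : StronglyConvexOnFeasible f h ρ) :
    ∃ ηs, reducedGradient f q Ψ ηs = 0 := by
  have hcont : Continuous (f ∘ slice Ψ) :=
    continuous_iff_continuousAt.2 fun η => (hasFDerivAt_reduced hnf hh hf η).continuousAt
  have hlim : Filter.Tendsto (f ∘ slice Ψ) (Filter.cocompact (Euc d)) Filter.atTop := by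
    -- Coercivity: strong convexity at the origin bounds the reduced objective below by a quadratic
    -- in `‖η‖`.
    set g := ‖reducedGradient f q Ψ 0‖
    have hN := tendsto_norm_cocompact_atTop (E := Euc d)
    have hquad : Filter.Tendsto (fun η : Euc d => ‖η‖ * (-g + ρ / 2 * ‖η‖) + f (slice Ψ 0))
        (Filter.cocompact (Euc d)) Filter.atTop :=
      Filter.tendsto_atTop_add_const_right _ _ (hN.atTop_mul_atTop₀
        (Filter.tendsto_atTop_add_const_left _ _ (hN.const_mul_atTop (by positivity))))
    refine Filter.tendsto_atTop_mono (fun η => ?_) hquad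
    have h1 := reduced_strongly_convex hnf hh hconv 0 η
    have h2 := neg_le_of_abs_le (abs_real_inner_le_norm (reducedGradient f q Ψ 0) η)
    rw [sub_zero] at h1
    simp only [Function.comp]
    nlinarith
  obtain ⟨ηs, hηs⟩ := hcont.exists_forall_le hlim
  refine ⟨ηs, ?_⟩
  have h0 := IsLocalMin.hasFDerivAt_eq_zero (Filter.Eventually.of_forall hηs)
    (hasFDerivAt_reduced hnf hh hf ηs)
  have := congrArg (fun A => A (reducedGradient f q Ψ ηs)) h0
  simpa using this

/-- Strong monotonicity of the reduced gradient, from adding the convexity inequalities in both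
directions. -/
theorem reducedGradient_inner_ge (hnf : IsNormalForm h q Ψ) (hh : Differentiable ℝ h) {ρ : ℝ}
    (hconv : StronglyConvexOnFeasible f h ρ) {ηs : Euc d} (hηs : reducedGradient f q Ψ ηs = 0)
    (η : Euc d) : ρ * ‖η - ηs‖ ^ 2 ≤ inner ℝ (η - ηs) (reducedGradient f q Ψ η) := by
  have h1 := reduced_strongly_convex hnf hh hconv ηs η
  have h2 := reduced_strongly_convex hnf hh hconv η ηs
  rw [hηs, inner_zero_left] at h1
  rw [← neg_sub η ηs, inner_neg_right, norm_neg, real_inner_comm] at h2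
  linarith

theorem isMinOn_slice (hnf : IsNormalForm h q Ψ) (hh : Differentiable ℝ h) {ρ : ℝ} (hρ : 0 < ρ)
    (hconv : StronglyConvexOnFeasible f h ρ) {ηs : Euc d} (hηs : reducedGradient f q Ψ ηs = 0) :
    IsMinOn f (feasible h) (slice Ψ ηs) ∧
      ∀ x ∈ feasible h, IsMinOn f (feasible h) x → x = slice Ψ ηs := by
  have key : ∀ x ∈ feasible h, f (slice Ψ ηs) + ρ / 2 * ‖q x - ηs‖ ^ 2 ≤ f x := fun x hx => by
    have := reduced_strongly_convex hnf hh hconv ηs (q x)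
    rwa [hηs, inner_zero_left, add_zero, hnf.slice_q hx] at this
  refine ⟨fun x hx => ?_, fun x hx hmin => ?_⟩
  · have := key x hx
    have : 0 ≤ ρ / 2 * ‖q x - ηs‖ ^ 2 := by positivity
    change f _ ≤ f _
    linarith
  · have h1 := key x hx
    have h2 : f x ≤ f (slice Ψ ηs) := hmin (hnf.h_slice ηs)
    have h3 : ‖q x - ηs‖ ^ 2 = 0 := by
      have : 0 ≤ ‖q x - ηs‖ ^ 2 := by positivity
      nlinarith
    rw [← hnf.slice_q hx, sub_eq_zero.1 (norm_eq_zero.1 (pow_eq_zero_iff two_ne_zero |>.1 h3))]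

/-! ### The multiplier -/

theorem gram_isInvertible {c : ℝ} (hc : 0 < c) {x : Euc n}
    (hgram : ∀ u, c * ‖u‖ ^ 2 ≤ inner ℝ u (gram h x u)) : (gram h x).IsInvertible := by
  have hinj : Function.Injective (gram h x).toLinearMap := by
    rw [← LinearMap.ker_eq_bot, LinearMap.ker_eq_bot']
    intro u hu
    have hu' : gram h x u = 0 := hu
    have h1 := hgram u
    rw [hu', inner_zero_right] at h1
    have h2 : ‖u‖ ^ 2 = 0 := by
      have : 0 ≤ ‖u‖ ^ 2 := by positivity
      nlinarith
    exact norm_eq_zero.1 (pow_eq_zero_iff two_ne_zero |>.1 h2)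
  exact ⟨(LinearEquiv.ofInjectiveEndo _ hinj).toContinuousLinearEquiv, by ext1 u; rfl⟩

theorem gram_phi {x : Euc n} (hinv : (gram h x).IsInvertible) :
    gram h x (phi f h x) = -jac h x (gradient f x) := by
  rw [phi, map_neg, (hinv.inverse_apply_eq.1 rfl).symm]

/-- `jac h` kills the sum by the definition of `φ`, and `jac q` kills it by criticality. -/
theorem gradient_add_jacT_phi (hnf : IsNormalForm h q Ψ) (hh : Differentiable ℝ h)
    {ηs : Euc d} (hηs : reducedGradient f q Ψ ηs = 0)
    (hinv : (gram h (slice Ψ ηs)).IsInvertible) :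
    gradient f (slice Ψ ηs) + jacT h (slice Ψ ηs) (phi f h (slice Ψ ηs)) = 0 := by
  refine hnf.eq_zero_of_jac_eq_zero hh (x := slice Ψ ηs) ?_ ?_
  · rw [map_add]
    change _ + gram h _ _ = 0
    rw [gram_phi hinv, add_neg_cancel]
  · rw [map_add, hnf.jac_q_jacT_h, add_zero]
    exact hηs

theorem multiplier_unique {x : Euc n} (hinv : (gram h x).IsInvertible) {l : Euc m}
    (hl : gradient f x + jacT h x l = 0) : l = phi f h x := by
  have h1 : gram h x l = gram h x (phi f h x) := by
    rw [gram_phi hinv, eq_neg_iff_add_eq_zero, add_comm]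
    have := congrArg (jac h x) hl
    rwa [map_add, map_zero] at this
  obtain ⟨A, hA⟩ := hinv
  rw [← hA] at h1
  exact A.injective h1

end NormalForm

end PIFlow

namespace PIFlow

/-! ### The closed loop -/

section ClosedLoop

variable {n m d : ℕ} {f : Euc n → ℝ} {h : Euc n → Euc m} {q : Euc n → Euc d}
  {Ψ : EucPair m d → Euc n} {kp ki : ℝ}

/-- The vector field of the PI dynamics. -/
noncomputable def piField (f : Euc n → ℝ) (h : Euc n → Euc m) (kp ki : ℝ) (p : Euc n × Euc m) :
    Euc n × Euc m :=
  (-gradient f p.1 - jacT h p.1 (multiplier h kp ki p.1 p.2), h p.1)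

theorem isPISolution_iff {x : ℝ → Euc n} {z : ℝ → Euc m} :
    IsPISolution f h kp ki x z ↔ ∀ t, 0 ≤ t →
      HasDerivWithinAt (fun t => (x t, z t)) (piField f h kp ki (x t, z t)) (Ici 0) t :=
  forall₂_congr fun _ _ => ⟨fun H => H.1.prodMk H.2, fun H =>
    ⟨(ContinuousLinearMap.fst ℝ (Euc n) (Euc m)).hasFDerivAt.comp_hasDerivWithinAt _ H,
      (ContinuousLinearMap.snd ℝ (Euc n) (Euc m)).hasFDerivAt.comp_hasDerivWithinAt _ H⟩⟩

theorem contDiff_gradient (hf : ContDiff ℝ 2 f) : ContDiff ℝ 1 (gradient f) := by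
  -- The duality is typed as conjugate-linear; it is rebuilt as a real-linear map from additivity
  -- and continuity.
  let T := (InnerProductSpace.toDual ℝ (Euc n)).symm.toLinearEquiv.toAddEquiv.toAddMonoidHom
    |>.toRealLinearMap (InnerProductSpace.toDual ℝ (Euc n)).symm.continuous
  exact T.contDiff.comp (hf.fderiv_right (m := 1) (by norm_num))

theorem contDiff_jacT (hh : ContDiff ℝ 2 h) : ContDiff ℝ 1 (jacT h) := by
  let T := (ContinuousLinearMap.adjoint (𝕜 := ℝ) (E := Euc n)
    (F := Euc m)).toLinearEquiv.toAddEquiv.toAddMonoidHom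
    |>.toRealLinearMap (ContinuousLinearMap.adjoint (𝕜 := ℝ)).continuous
  exact T.contDiff.comp (hh.fderiv_right (m := 1) (by norm_num))

theorem contDiff_piField (hf : ContDiff ℝ 2 f) (hh : ContDiff ℝ 2 h) :
    ContDiff ℝ 1 (piField f h kp ki) := by
  have h1 := (contDiff_gradient hf).comp (contDiff_fst (E := Euc n) (F := Euc m))
  have h2 := (contDiff_jacT hh).comp (contDiff_fst (E := Euc n) (F := Euc m))
  have h3 := (hh.of_le (m := 1) (by norm_num)).comp (contDiff_fst (E := Euc n) (F := Euc m))
  exact (h1.neg.sub (h2.clm_apply ((h3.const_smul kp).add (contDiff_snd.const_smul ki)))).prodMk h3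

/-- The Lyapunov function `‖λ - λ*‖² + b ‖kᵢ z - λ*‖² + c ‖q - η*‖²`. -/
noncomputable def lyapunov (h : Euc n → Euc m) (q : Euc n → Euc d) (kp ki b c : ℝ) (ls : Euc m)
    (ηs : Euc d) (p : Euc n × Euc m) : ℝ :=
  ‖multiplier h kp ki p.1 p.2 - ls‖ ^ 2 + b * ‖ki • p.2 - ls‖ ^ 2 + c * ‖q p.1 - ηs‖ ^ 2

variable {b c : ℝ} {ls : Euc m} {ηs : Euc d}

theorem hasFDerivAt_lyapunov (hh : Differentiable ℝ h) (hq : Differentiable ℝ q)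
    (p : Euc n × Euc m) :
    HasFDerivAt (lyapunov h q kp ki b c ls ηs)
      (2 • (innerSL ℝ (multiplier h kp ki p.1 p.2 - ls)).comp
          (kp • (jac h p.1).comp (ContinuousLinearMap.fst ℝ _ _)
            + ki • ContinuousLinearMap.snd ℝ _ _)
        + b • (2 • (innerSL ℝ (ki • p.2 - ls)).comp (ki • ContinuousLinearMap.snd ℝ _ _))
        + c • (2 • (innerSL ℝ (q p.1 - ηs)).comp
            ((jac q p.1).comp (ContinuousLinearMap.fst ℝ _ _)))) p := by
  have h1 : HasFDerivAt (fun p : Euc n × Euc m => h p.1) _ p :=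
    (hh p.1).hasFDerivAt.comp p hasFDerivAt_fst
  have h2 : HasFDerivAt (fun p : Euc n × Euc m => q p.1) _ p :=
    (hq p.1).hasFDerivAt.comp p hasFDerivAt_fst
  have h3 : HasFDerivAt (fun p : Euc n × Euc m => ki • p.2) _ p :=
    (hasFDerivAt_snd (𝕜 := ℝ) (p := p)).const_smul ki
  exact ((((h1.const_smul kp).add h3).sub_const ls).norm_sq.add
    ((h3.sub_const ls).norm_sq.const_mul b)).add ((h2.sub_const ηs).norm_sq.const_mul c)

/-- Since `-∇ᵀh ∇f = gram φ`, the constraint value evolves by `gram (φ(x) - λ)`; inserting `φ(x*)`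
separates the Lipschitz perturbation from the damping. -/
theorem jac_h_velocity {xs : Euc n} {x : Euc n} (z : Euc m) (hinv : (gram h x).IsInvertible) :
    jac h x (-gradient f x - jacT h x (multiplier h kp ki x z)) =
      gram h x (phi f h x - phi f h xs) - gram h x (multiplier h kp ki x z - phi f h xs) := by
  rw [← map_sub (gram h x), sub_sub_sub_cancel_right, map_sub, map_sub, gram_phi hinv, map_neg]
  rfl

theorem jac_q_velocity (hnf : IsNormalForm h q Ψ) (x : Euc n) (l : Euc m) :
    jac q x (-gradient f x - jacT h x l) = -jac q x (gradient f x) := by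
  rw [map_sub, map_neg, hnf.jac_q_jacT_h, sub_zero]

/-- Compare with the feasible point having the same `q`-coordinate: there the reduced gradient is
strongly monotone, and the discrepancy is at most `L₁ ‖h x‖`. -/
theorem transverse_inner_ge (hnf : IsNormalForm h q Ψ) (hh : Differentiable ℝ h) {ρ L₁ : ℝ}
    (hconv : StronglyConvexOnFeasible f h ρ) (hηs : reducedGradient f q Ψ ηs = 0)
    (htr : ∀ (y : Euc m) (η : Euc d),
      ‖jac q (Ψ (stack y η)) (gradient f (Ψ (stack y η)))
        - jac q (Ψ (stack 0 η)) (gradient f (Ψ (stack 0 η)))‖ ≤ L₁ * ‖y‖) (x : Euc n) :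
    ρ * ‖q x - ηs‖ ^ 2 - L₁ * ‖h x‖ * ‖q x - ηs‖ ≤
      inner ℝ (q x - ηs) (jac q x (gradient f x)) := by
  have h1 := reducedGradient_inner_ge hnf hh hconv hηs (q x)
  have h2 := htr (h x) (q x)
  rw [show Ψ (stack (h x) (q x)) = x from hnf.left_inv x] at h2
  have h3 := neg_le_of_abs_le (abs_real_inner_le_norm (q x - ηs)
    (jac q x (gradient f x) - reducedGradient f q Ψ (q x)))
  rw [inner_sub_right] at h3
  have h4 := mul_le_mul_of_nonneg_left h2 (norm_nonneg (q x - ηs))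
  change ‖q x - ηs‖ * ‖_ - reducedGradient f q Ψ (q x)‖ ≤ _ at h4
  nlinarith

theorem norm_gram_phi_sub_le (hnf : IsNormalForm h q Ψ) {mup ℓ : ℝ} {LΨ L₂ : NNReal}
    (hgram : ∀ x, ‖gram h x‖ ≤ mup) (hΨ : LipschitzWith LΨ Ψ) (hφ : LipschitzWith L₂ (phi f h))
    (hℓ : mup * L₂ * LΨ ≤ ℓ) (x : Euc n) :
    ‖gram h x (phi f h x - phi f h (slice Ψ ηs))‖ ≤ ℓ * (‖h x‖ + ‖q x - ηs‖) := by
  have hmup : 0 ≤ mup := (norm_nonneg _).trans (hgram x)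
  have h1 : ‖x - slice Ψ ηs‖ ≤ LΨ * (‖h x‖ + ‖q x - ηs‖) := by
    have := hΨ.norm_sub_le (Phi h q x) (stack 0 ηs)
    rw [hnf.left_inv, Phi, stack_sub_stack, sub_zero] at this
    exact this.trans (mul_le_mul_of_nonneg_left (norm_stack_le _ _) LΨ.2)
  calc _ ≤ mup * (L₂ * (LΨ * (‖h x‖ + ‖q x - ηs‖))) := by
        refine (ContinuousLinearMap.le_of_opNorm_le _ (hgram x) _).trans ?_
        gcongr
        exact (hφ.norm_sub_le _ _).trans (by gcongr)
    _ = mup * L₂ * LΨ * (‖h x‖ + ‖q x - ηs‖) := by ring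
    _ ≤ _ := by gcongr

theorem kp_smul_h (x : Euc n) (z ls : Euc m) :
    kp • h x = (multiplier h kp ki x z - ls) - (ki • z - ls) := by
  rw [multiplier]; abel

theorem fderiv_lyapunov_piField_le (hnf : IsNormalForm h q Ψ) (hh : Differentiable ℝ h)
    {mlow mup ρ ℓ L₁ : ℝ} {LΨ L₂ : NNReal} (hmlow : 0 < mlow)
    (hlower : ∀ x u, mlow * ‖u‖ ^ 2 ≤ inner ℝ u (gram h x u)) (hupper : ∀ x, ‖gram h x‖ ≤ mup)
    (hρ : 0 < ρ) (hconv : StronglyConvexOnFeasible f h ρ)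
    (hΨ : LipschitzWith LΨ Ψ) (hL₁ : 0 ≤ L₁)
    (htr : ∀ (y : Euc m) (η : Euc d),
      ‖jac q (Ψ (stack y η)) (gradient f (Ψ (stack y η)))
        - jac q (Ψ (stack 0 η)) (gradient f (Ψ (stack 0 η)))‖ ≤ L₁ * ‖y‖)
    (hφ : LipschitzWith L₂ (phi f h)) (hkp : 0 < kp) (hki : 0 < ki)
    (hk : 2 * (ki / kp) ≤ mlow * kp) (hℓ : 0 < ℓ) (hLr : mup * L₂ * LΨ ≤ ℓ)
    (h12 : 12 * ℓ ≤ mlow * kp) (h11 : 11 * (ℓ * L₁) ≤ mlow * ρ * kp)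
    (hηs : reducedGradient f q Ψ ηs = 0) (p : Euc n × Euc m) :
    fderiv ℝ (lyapunov h q kp ki (mlow * kp ^ 2 / ki) (4 * ℓ ^ 2 * kp / (mlow * ρ))
        (phi f h (slice Ψ ηs)) ηs) p (piField f h kp ki p) ≤
      -(2 * decayRate mlow ρ kp ki) *
        lyapunov h q kp ki (mlow * kp ^ 2 / ki) (4 * ℓ ^ 2 * kp / (mlow * ρ))
          (phi f h (slice Ψ ηs)) ηs p := by
  obtain ⟨x, z⟩ := p
  have hdis := lyapunov_dissipation_le hmlow hρ hkp hki hℓ hL₁ h12 h11 hk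
    (kp_smul_h (ki := ki) x z (phi f h (slice Ψ ηs))) (hlower x _)
    (norm_gram_phi_sub_le hnf hupper hΨ hφ hLr x)
    (transverse_inner_ge hnf hh hconv hηs htr x)
  rw [(hasFDerivAt_lyapunov hh hnf.differentiable_q (x, z)).fderiv]
  simp only [add_apply, smul_apply,
    ContinuousLinearMap.comp_apply, ContinuousLinearMap.coe_fst', ContinuousLinearMap.coe_snd',
    innerSL_apply_apply, piField, jac_q_velocity hnf, inner_neg_right,
    jac_h_velocity (xs := slice Ψ ηs) z (gram_isInvertible hmlow (hlower x)),
    smul_eq_mul, nsmul_eq_mul, Nat.cast_ofNat, lyapunov]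
  -- The derivative is twice the left side of `hdis`, whence the factor 2 in the rate.
  linarith

/-! ### Comparison of the Lyapunov function with the distance to the equilibrium -/

theorem norm_sq_stack_le_lyapunov (hnf : IsNormalForm h q Ψ) {LΨ : NNReal}
    (hΨ : LipschitzWith LΨ Ψ) (hkp : 1 ≤ kp) (hb : 0 < b) (hc : 0 < c) (x : Euc n) (z : Euc m) :
    ‖stack (x - slice Ψ ηs) (multiplier h kp ki x z - ls)‖ ^ 2 ≤
      (1 + (LΨ : ℝ) ^ 2 * (2 + 2 / b + 1 / c)) * lyapunov h q kp ki b c ls ηs (x, z) := by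
  have h1 : ‖x - slice Ψ ηs‖ ^ 2 ≤ (LΨ : ℝ) ^ 2 * (‖h x‖ ^ 2 + ‖q x - ηs‖ ^ 2) := by
    have := hΨ.norm_sub_le (Phi h q x) (stack 0 ηs)
    rw [hnf.left_inv, Phi, stack_sub_stack, sub_zero] at this
    rw [← norm_stack_sq, ← mul_pow]
    exact pow_le_pow_left₀ (norm_nonneg _) this 2
  have h2 : ‖h x‖ ^ 2 ≤ 2 * ‖multiplier h kp ki x z - ls‖ ^ 2 + 2 * ‖ki • z - ls‖ ^ 2 := by
    have e := kp_smul_h (h := h) (kp := kp) (ki := ki) x z ls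
    set u := multiplier h kp ki x z - ls
    set t := ki • z - ls
    have h3 : ‖h x‖ ≤ ‖u‖ + ‖t‖ := by
      -- Here `kp ≥ 1` keeps the comparison constant independent of `kp` apart from the weights.
      calc ‖h x‖ ≤ kp * ‖h x‖ := le_mul_of_one_le_left (norm_nonneg _) hkp
        _ = ‖kp • h x‖ := by rw [norm_smul, Real.norm_of_nonneg (by linarith)]
        _ ≤ _ := by rw [e]; exact norm_sub_le _ _
    have := pow_le_pow_left₀ (norm_nonneg _) h3 2
    nlinarith [sq_nonneg (‖u‖ - ‖t‖)]
  rw [norm_stack_sq]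
  simp only [lyapunov]
  set u := ‖multiplier h kp ki x z - ls‖ ^ 2
  set t := ‖ki • z - ls‖ ^ 2
  set e := ‖q x - ηs‖ ^ 2
  have hu0 : 0 ≤ u := by positivity
  have ht0 : 0 ≤ t := by positivity
  have he0 : 0 ≤ e := by positivity
  have a1 : u ≤ u + b * t + c * e := by nlinarith [mul_nonneg hb.le ht0, mul_nonneg hc.le he0]
  have a2 : 2 * t ≤ 2 / b * (u + b * t + c * e) := by
    rw [div_mul_eq_mul_div, le_div_iff₀ hb]; nlinarith [mul_nonneg hc.le he0]
  have a3 : e ≤ 1 / c * (u + b * t + c * e) := by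
    rw [div_mul_eq_mul_div, le_div_iff₀ hc]; nlinarith [mul_nonneg hb.le ht0]
  calc _ ≤ (LΨ : ℝ) ^ 2 * (2 * u + 2 * t + e) + u := by
        gcongr
        exact h1.trans (by gcongr)
    _ ≤ (LΨ : ℝ) ^ 2 * ((2 + 2 / b + 1 / c) * (u + b * t + c * e)) + (u + b * t + c * e) := by
        gcongr
        linarith
    _ = _ := by ring

theorem lyapunov_le_norm_sq_stack (hnf : IsNormalForm h q Ψ) {LΦ : NNReal}
    (hΦ : LipschitzWith LΦ (Phi h q)) (hb : 0 < b) (hc : 0 < c) (x : Euc n) (z : Euc m) :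
    lyapunov h q kp ki b c ls ηs (x, z) ≤ (1 + 2 * b + (2 * b * kp ^ 2 + c) * (LΦ : ℝ) ^ 2) *
      ‖stack (x - slice Ψ ηs) (multiplier h kp ki x z - ls)‖ ^ 2 := by
  have h1 : ‖h x‖ ^ 2 + ‖q x - ηs‖ ^ 2 ≤ (LΦ : ℝ) ^ 2 * ‖x - slice Ψ ηs‖ ^ 2 := by
    have := hΦ.norm_sub_le x (slice Ψ ηs)
    rw [hnf.Phi_slice, Phi, stack_sub_stack, sub_zero] at this
    rw [← norm_stack_sq, ← mul_pow]
    exact pow_le_pow_left₀ (norm_nonneg _) this 2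
  have h2 : ‖ki • z - ls‖ ^ 2 ≤
      2 * ‖multiplier h kp ki x z - ls‖ ^ 2 + 2 * kp ^ 2 * ‖h x‖ ^ 2 := by
    have e : ki • z - ls = (multiplier h kp ki x z - ls) - kp • h x := by
      rw [multiplier]; abel
    have h3 := norm_sub_le (multiplier h kp ki x z - ls) (kp • h x)
    rw [← e] at h3
    have h4 : ‖kp • h x‖ ^ 2 = kp ^ 2 * ‖h x‖ ^ 2 := by rw [norm_smul, mul_pow, Real.norm_eq_abs,
      sq_abs]
    have := pow_le_pow_left₀ (norm_nonneg _) h3 2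
    nlinarith [sq_nonneg (‖multiplier h kp ki x z - ls‖ - ‖kp • h x‖)]
  rw [norm_stack_sq]
  simp only [lyapunov]
  set u := ‖multiplier h kp ki x z - ls‖ ^ 2
  set X := ‖x - slice Ψ ηs‖ ^ 2
  have hu0 : 0 ≤ u := by positivity
  have hX0 : 0 ≤ X := by positivity
  have hy : ‖h x‖ ^ 2 ≤ (LΦ : ℝ) ^ 2 * X := by nlinarith [sq_nonneg ‖q x - ηs‖]
  have he : ‖q x - ηs‖ ^ 2 ≤ (LΦ : ℝ) ^ 2 * X := by nlinarith [sq_nonneg ‖h x‖]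
  calc _ ≤ u + b * (2 * u + 2 * kp ^ 2 * ((LΦ : ℝ) ^ 2 * X)) + c * ((LΦ : ℝ) ^ 2 * X) := by
        gcongr
        exact h2.trans (by gcongr)
    _ = (1 + 2 * b) * u + (2 * b * kp ^ 2 + c) * (LΦ : ℝ) ^ 2 * X := by ring
    _ ≤ (1 + 2 * b) * (X + u) + (2 * b * kp ^ 2 + c) * (LΦ : ℝ) ^ 2 * (X + u) := by
        gcongr <;> linarith
    _ = _ := by ring

theorem bounded_sublevel_lyapunov (hnf : IsNormalForm h q Ψ) {LΨ : NNReal}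
    (hΨ : LipschitzWith LΨ Ψ) (hkp : 1 ≤ kp) (hki : 0 < ki) (hb : 0 < b) (hc : 0 < c) (C : ℝ) :
    ∃ R, ∀ p, lyapunov h q kp ki b c ls ηs p ≤ C → ‖p‖ ≤ R := by
  set K := (1 + (LΨ : ℝ) ^ 2 * (2 + 2 / b + 1 / c))
  refine ⟨max (√(K * C) + ‖slice Ψ ηs‖) ((√(C / b) + ‖ls‖) / ki), fun ⟨x, z⟩ hp => ?_⟩
  rw [Prod.norm_mk]
  refine max_le_max ?_ ?_
  · have h1 := norm_sq_stack_le_lyapunov (ki := ki) (ls := ls) (ηs := ηs) hnf hΨ hkp hb hc x z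
    rw [norm_stack_sq] at h1
    have h2 : ‖x - slice Ψ ηs‖ ≤ √(K * C) := Real.le_sqrt_of_sq_le <| by
      have : K * lyapunov h q kp ki b c ls ηs (x, z) ≤ K * C := by gcongr
      nlinarith [sq_nonneg ‖multiplier h kp ki x z - ls‖]
    calc ‖x‖ = ‖(x - slice Ψ ηs) + slice Ψ ηs‖ := by rw [sub_add_cancel]
      _ ≤ _ := (norm_add_le _ _).trans (by gcongr)
  · have h2 : ‖ki • z - ls‖ ≤ √(C / b) := Real.le_sqrt_of_sq_le <| by
      rw [le_div_iff₀ hb]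
      have h3 : 0 ≤ c * ‖q x - ηs‖ ^ 2 := by positivity
      have h4 : 0 ≤ ‖multiplier h kp ki x z - ls‖ ^ 2 := by positivity
      simp only [lyapunov] at hp
      linarith
    rw [le_div_iff₀ hki]
    calc ‖z‖ * ki = ‖(ki • z - ls) + ls‖ := by
          rw [sub_add_cancel, norm_smul, Real.norm_of_nonneg hki.le, mul_comm]
      _ ≤ _ := (norm_add_le _ _).trans (by gcongr)

theorem isGloballyExpStable_of_lyapunov (hnf : IsNormalForm h q Ψ) (hf : ContDiff ℝ 2 f)
    (hh : ContDiff ℝ 2 h) {LΦ LΨ : NNReal} (hΦ : LipschitzWith LΦ (Phi h q))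
    (hΨ : LipschitzWith LΨ Ψ) (hkp : 1 ≤ kp) (hki : 0 < ki) (hb : 0 < b) (hc : 0 < c) {δ : ℝ}
    (hδ : 0 < δ)
    (hdec : ∀ p, fderiv ℝ (lyapunov h q kp ki b c ls ηs) p (piField f h kp ki p) ≤
      -(2 * δ) * lyapunov h q kp ki b c ls ηs p)
    (hkkt : gradient f (slice Ψ ηs) + jacT h (slice Ψ ηs) ls = 0) :
    IsGloballyExpStable f h kp ki (slice Ψ ηs) ls := by
  have hV0 : ∀ p, 0 ≤ lyapunov h q kp ki b c ls ηs p := fun p => by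
    unfold lyapunov; positivity
  have hdiff : Differentiable ℝ (lyapunov h q kp ki b c ls ηs) := fun p =>
    (hasFDerivAt_lyapunov (hh.differentiable (by norm_num)) hnf.differentiable_q
      p).differentiableAt
  refine ⟨⟨ki⁻¹ • ls, ?_, fun t _ => ⟨?_, ?_⟩⟩, fun x₀ z₀ => ?_, ?_⟩
  · rw [multiplier, hnf.h_slice, smul_zero, zero_add, smul_inv_smul₀ hki.ne']
  · rw [multiplier, hnf.h_slice, smul_zero, zero_add, smul_inv_smul₀ hki.ne', ← neg_add', hkkt,
      neg_zero]
    exact hasDerivWithinAt_const _ _ _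
  · rw [hnf.h_slice]
    exact hasDerivWithinAt_const _ _ _
  · obtain ⟨γ, hγ0, hγ⟩ := exists_global_solution_of_lyapunov
      (contDiff_piField (kp := kp) (ki := ki) hf hh) hdiff
      (fun p => (hdec p).trans (by nlinarith [hV0 p]))
      (bounded_sublevel_lyapunov hnf hΨ hkp hki hb hc) (x₀, z₀)
    exact ⟨fun t => (γ t).1, fun t => (γ t).2, isPISolution_iff.2 hγ, by simp [hγ0], by simp [hγ0]⟩
  · set K := 1 + (LΨ : ℝ) ^ 2 * (2 + 2 / b + 1 / c)
    set K' := 1 + 2 * b + (2 * b * kp ^ 2 + c) * (LΦ : ℝ) ^ 2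
    have hK : 0 < K := by positivity
    have hK' : 0 < K' := by positivity
    -- The Lyapunov function is quadratic in the distance, so square roots turn the constant `K *
    -- K'` and rate `2 * δ` into these.
    refine ⟨√(K * K'), by positivity, δ, hδ, fun x z hsol t ht => ?_⟩
    have hV := le_exp_mul_of_hasDerivWithinAt
      (W := lyapunov h q kp ki b c ls ηs ∘ fun t => (x t, z t))
      (fun s hs => (hdiff (x s, z s)).hasFDerivAt.comp_hasDerivWithinAt s
        (isPISolution_iff.1 hsol s hs))
      (fun s _ => hdec (x s, z s)) ht
    refine abs_le_of_sq_le_sq' ?_ (by positivity) |>.2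
    have hexp : Real.exp (-(2 * δ) * t) = Real.exp (-δ * t) ^ 2 := by
      rw [← Real.exp_nat_mul]; congr 1; push_cast; ring
    rw [mul_pow, mul_pow, Real.sq_sqrt (by positivity), ← hexp]
    calc _ ≤ K * lyapunov h q kp ki b c ls ηs (x t, z t) :=
          norm_sq_stack_le_lyapunov hnf hΨ hkp hb hc _ _
      _ ≤ K * (Real.exp (-(2 * δ) * t) * (K' *
            ‖stack (x 0 - slice Ψ ηs) (multiplier h kp ki (x 0) (z 0) - ls)‖ ^ 2)) := by
          gcongr
          refine hV.trans ?_
          gcongr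
          exact lyapunov_le_norm_sq_stack hnf hΦ hb hc _ _
      _ = _ := by ring

end ClosedLoop

end PIFlow

theorem mainTheorem4 (n m : ℕ)
    (f : Euc n → ℝ) (h : Euc n → Euc m)
    (q : Euc n → Euc (n - m)) (Ψ : EucPair m (n - m) → Euc n)
    (mlow mup ρη L₁ : ℝ) (LΦ LΨ L₂ : NNReal) (kp ki : ℝ)
    (hf : ContDiff ℝ ∞ f) (hh : ContDiff ℝ ∞ h)
    (hmlow : 0 < mlow)
    (hgram_lower : ∀ (x : Euc n) (u : Euc m), mlow * ‖u‖ ^ 2 ≤ inner ℝ u (PIFlow.gram h x u))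
    (hmup : 0 < mup)
    (hgram_upper : ∀ x : Euc n, ‖PIFlow.gram h x‖ ≤ mup)
    (hρη : 0 < ρη) (hconv : PIFlow.StronglyConvexOnFeasible f h ρη)
    (hnf : PIFlow.IsNormalForm h q Ψ)
    (hΦ_lip : LipschitzWith LΦ (PIFlow.Phi h q)) (hΨ_lip : LipschitzWith LΨ Ψ)
    (hL₁ : 0 ≤ L₁)
    (htransverse : ∀ (y : Euc m) (η : Euc (n - m)),
      ‖PIFlow.jac q (Ψ (PIFlow.stack y η)) (gradient f (Ψ (PIFlow.stack y η)))
        - PIFlow.jac q (Ψ (PIFlow.stack 0 η)) (gradient f (Ψ (PIFlow.stack 0 η)))‖ ≤ L₁ * ‖y‖)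
    (hphi_lip : LipschitzWith L₂ (PIFlow.phi f h))
    (hki_pos : 0 < ki)
    (hkp : max (max 1 (2 * (ki / kp) / mlow)) (PIFlow.kappa mlow ρη L₁ (mup * L₂ * LΨ)) ≤ kp)
    (hki : ki ≤ mlow * kp ^ 2 / 2) :
    ∃ (xs : Euc n) (ls : Euc m),
      (xs ∈ PIFlow.feasible h ∧ IsMinOn f (PIFlow.feasible h) xs ∧
        ∀ x ∈ PIFlow.feasible h, IsMinOn f (PIFlow.feasible h) x → x = xs) ∧
      (gradient f xs + PIFlow.jacT h xs ls = 0 ∧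
        ∀ l : Euc m, gradient f xs + PIFlow.jacT h xs l = 0 → l = ls) ∧
      PIFlow.IsGloballyExpStable f h kp ki xs ls := by
  have hh1 : Differentiable ℝ h := hh.differentiable (by simp)
  have hf2 : ContDiff ℝ 2 f := mod_cast contDiff_infty.1 hf 2
  have hh2 : ContDiff ℝ 2 h := mod_cast contDiff_infty.1 hh 2
  obtain ⟨⟨hkp1, hk⟩, hκ⟩ : (1 ≤ kp ∧ 2 * (ki / kp) / mlow ≤ kp) ∧
      PIFlow.kappa mlow ρη L₁ (mup * L₂ * LΨ) ≤ kp := by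
    simpa only [max_le_iff] using hkp
  have hkp0 : 0 < kp := by linarith
  rw [div_le_iff₀ hmlow, mul_comm kp] at hk
  obtain ⟨ℓ, hℓ, hLr, h12, h11⟩ := PIFlow.exists_pos_margin hmlow hρη hL₁
    (by positivity : 0 ≤ mup * (L₂ : ℝ) * LΨ) hkp1 hκ
  obtain ⟨ηs, hηs⟩ := PIFlow.exists_reduced_critical_point hnf hh1
    (hf.differentiable (by simp)) hρη hconv
  have hinv := PIFlow.gram_isInvertible hmlow (hgram_lower (PIFlow.slice Ψ ηs))
  have hkkt := PIFlow.gradient_add_jacT_phi hnf hh1 hηs hinv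
  exact ⟨PIFlow.slice Ψ ηs, PIFlow.phi f h (PIFlow.slice Ψ ηs),
    ⟨hnf.h_slice ηs, PIFlow.isMinOn_slice hnf hh1 hρη hconv hηs⟩,
    ⟨hkkt, fun l hl => PIFlow.multiplier_unique hinv hl⟩,
    PIFlow.isGloballyExpStable_of_lyapunov hnf hf2 hh2 hΦ_lip hΨ_lip hkp1 hki_pos
      (by positivity) (by positivity) (PIFlow.decayRate_pos hmlow hρη hkp0 hki_pos)
      (PIFlow.fderiv_lyapunov_piField_le hnf hh1 hmlow hgram_lower hgram_upper hρη hconv hΨ_lip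
        hL₁ htransverse hphi_lip hkp0 hki_pos hk hℓ hLr h12 h11 hηs) hkkt⟩
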